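/- For elements $x,y$ of a group write $[x,y]=x^{-1}y^{-1}xy$, and let $[G,G]$ be the commutator subgroup of $G$. Let $\mathcal N_2$ be the variety of all groups that are nilpotent of class at most $2$. For $G\in\mathcal N_2$ and a subgroup $H\le G$, the dominion of $H$ in $G$ in $\mathcal N_2$ is $$\mathrm{dom}_G^{\mathcal N_2}(H)=\{a\in G : \text{for all } K\in\mathcal N_2 \text{ and all homomorphisms } f,g\colon G\to K,\ \text{if } f|_H=g|_H \text{ then } f(a)=g(a)\}.$$ Theorem. Let $G\in\mathcal N_2$ and let $H$ be a subgroup of $G$. Let $D$ be the subgroup of $G$ generated by all elements of $H$ together with all elements of the form $[x,y]^q$, where $x,y\in G$, $q\ge 0$ is an integer, and there exist $x',y'\in[G,G]$ such that $x^q x'\in H$ and $y^q y'\in H$. Then $D=\mathrm{dom}_G^{\mathcal N_2}(H)$. -/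

import Mathlib

universe u

/-- `G` is nilpotent of class at most `c`: the lower central series `G₁ = G`, `Gᵢ₊₁ = [Gᵢ, G]`
satisfies `G_{c+1} = 1`. Mathlib's series starts at index `0`, so `G_{c+1}` has index `c`. -/
def NilpotentOfClassLE (c : ℕ) (G : Type u) [Group G] : Prop :=
  (⊤ : Subgroup G).lowerCentralSeries c = ⊥

/-- The dominion of the subgroup `H` of `G` in the full subcategory of groups given by the
predicate `𝒞`: the elements of `G` on which any two morphisms from `G` to a group of `𝒞` agree as
soon as they agree on `H`. -/
def dominion (𝒞 : ∀ (K : Type u) [Group K], Prop) {G : Type u} [Group G] (H : Subgroup G) :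
    Subgroup G where
  carrier := {a | ∀ (K : Type u) [Group K], 𝒞 K → ∀ f g : G →* K,
    (∀ h ∈ H, f h = g h) → f a = g a}
  one_mem' := by
    intro K _ _ f g _
    rw [map_one, map_one]
  mul_mem' := by
    intro a b ha hb K _ hK f g hfg
    rw [map_mul, map_mul, ha K hK f g hfg, hb K hK f g hfg]
  inv_mem' := by
    intro a ha K _ hK f g hfg
    rw [map_inv, map_inv, ha K hK f g hfg]

/-!
A commutator in a group of class two is central and bilinear, so `[x, y] ^ q` depends only on
`x ^ q` and `y` up to commutators, and equally only on `x` and `y ^ q`; this puts the generators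
of `D` in the dominion.

Conversely, commutative groups show that the dominion lies in `H [G, G]`, so it remains to separate
an element `c ∈ [G, G]` outside `D`. Choose a character `χ` of the center with values in `ℚ/ℤ` that
is trivial on `D` and not at `c`. Let `A = G/[G, G]`, let `B` be the image of `H` in `A`, and let
`b x y = χ [x, y]` be the resulting pairing on `A`. That `χ` kills the generators of `D` says that
`b` induces a pairing of `A/B` and `B` which vanishes on the image of `Tor₁(A/B, A/B)`, the kernel
of `A/B ⊗ B → A/B ⊗ A`. As `ℚ/ℤ` is injective, it extends to a pairing `γ` of `A/B` and `A`. Through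
`γ`, the group `G` acts on `A × ℚ/ℤ`; a quotient of the semidirect product identifies each `h ∈ H`
with its image in `A` and each `z ∈ [G, G]` with `χ z`. It has class two, and the maps from `G`
through the two factors agree on `H` but not at `c`.
-/

open TensorProduct

section Pairing

variable {R : Type*} [CommRing R]

theorem exists_cyclic_generators [IsDomain R] [IsPrincipalIdealRing R] (C : Type*) [AddCommGroup C]
    [Module R C] [Module.Finite R C] :
    ∃ (n : ℕ) (e : Fin n → C) (d : Fin n → R), Submodule.span R (Set.range e) = ⊤ ∧
      (∀ i, d i • e i = 0) ∧ ∀ s : Fin n → R, ∑ i, s i • e i = 0 → ∀ i, d i ∣ s i := by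
  obtain ⟨n, f, hf⟩ := Module.Finite.exists_fin' R C
  obtain ⟨m, S⟩ := (LinearMap.ker f).smithNormalForm (Pi.basisFun R (Fin n))
  refine ⟨n, f ∘ S.bM, Function.extend S.f S.a 0, ?_, fun i => ?_, fun s hs i => ?_⟩
  · rw [Set.range_comp, Submodule.span_image, S.bM.span_eq, Submodule.map_top,
      LinearMap.range_eq_top.2 hf]
  · by_cases hi : ∃ k, S.f k = i
    · obtain ⟨k, rfl⟩ := hi
      rw [S.f.injective.extend_apply, Function.comp_apply, ← map_smul, ← S.snf]
      exact (S.bN k).2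
    · rw [Function.extend_apply' _ _ _ hi, Pi.zero_apply, zero_smul]
  · have hker : ∑ i, s i • S.bM i ∈ LinearMap.ker f := by simpa using hs
    have hrepr : S.bM.repr (∑ i, s i • S.bM i) i = s i := by rw [S.bM.repr_sum_self]
    by_cases hi : ∃ k, S.f k = i
    · obtain ⟨k, rfl⟩ := hi
      have := S.repr_apply_embedding_eq_repr_smul ⟨_, hker⟩ (i := k)
      rw [hrepr, map_smul, Finsupp.smul_apply, smul_eq_mul] at this
      rw [S.f.injective.extend_apply, this]
      exact dvd_mul_right _ _
    · rw [← hrepr, S.repr_eq_zero_of_notMem_range ⟨_, hker⟩ hi]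
      exact dvd_zero _

variable {A C D M N : Type*} [AddCommGroup A] [Module R A] [AddCommGroup C] [Module R C]
  [AddCommGroup D] [Module R D] [AddCommGroup M] [Module R M] [AddCommGroup N] [Module R N]

theorem exists_sum_tmul_of_span_eq_top {ι : Type*} [Fintype ι] {e : ι → C}
    (he : Submodule.span R (Set.range e) = ⊤) (t : C ⊗[R] N) :
    ∃ b : ι → N, t = ∑ i, e i ⊗ₜ[R] b i := by
  induction t with
  | zero => exact ⟨0, by simp⟩
  | tmul c y =>
    obtain ⟨s, rfl⟩ :=
      (Submodule.mem_span_range_iff_exists_fun R).1 (he ▸ Submodule.mem_top (x := c))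
    exact ⟨fun i => s i • y, by simp only [sum_tmul, smul_tmul]⟩
  | add t u ht hu =>
    obtain ⟨⟨a, rfl⟩, ⟨b, rfl⟩⟩ := ht, hu
    exact ⟨a + b, by simp only [Pi.add_apply, tmul_add, Finset.sum_add_distrib]⟩

variable (C) in
/-- The span of the elementary tensors killed by `C ⊗ f` because a scalar moves from one factor to
the other. Over a principal ideal domain, for injective `f`, this is the image of
`Tor₁(C, A ⧸ range f)` in `C ⊗ N`. -/
def torsionTensors (f : N →ₗ[R] A) : Submodule R (C ⊗[R] N) :=
  Submodule.span R {t | ∃ (r : R) (c : C) (y : N) (a : A), r • c = 0 ∧ f y = r • a ∧ c ⊗ₜ y = t}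

theorem map_rTensor_torsionTensors_le (g : C →ₗ[R] D) (f : N →ₗ[R] A) :
    (torsionTensors C f).map (g.rTensor N) ≤ torsionTensors D f := by
  rw [torsionTensors, Submodule.map_span_le]
  rintro _ ⟨r, c, y, a, hc, hy, rfl⟩
  exact Submodule.subset_span ⟨r, g c, y, a, by rw [← map_smul, hc, map_zero], hy, rfl⟩

theorem torsionTensors_le_ker_lTensor (f : N →ₗ[R] A) :
    torsionTensors C f ≤ LinearMap.ker (f.lTensor C) := by
  rw [torsionTensors, Submodule.span_le]
  rintro _ ⟨r, c, y, a, hc, hy, rfl⟩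
  rw [SetLike.mem_coe, LinearMap.mem_ker, LinearMap.lTensor_tmul, hy, ← smul_tmul, hc, zero_tmul]

theorem ker_lTensor_le_torsionTensors_of_finite [IsDomain R] [IsPrincipalIdealRing R]
    [Module.Finite R C] (f : N →ₗ[R] A) :
    LinearMap.ker (f.lTensor C) ≤ torsionTensors C f := by
  intro t ht
  obtain ⟨n, e, d, he, hde, hd⟩ := exists_cyclic_generators (R := R) C
  obtain ⟨b, rfl⟩ := exists_sum_tmul_of_span_eq_top he t
  have hsum : ∑ i, e i ⊗ₜ[R] f (b i) = 0 := by simpa using ht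
  obtain ⟨k, s, y, hb, hs⟩ := vanishesTrivially_of_sum_tmul_eq_zero R he hsum
  choose u hu using fun j => hd _ (hs j)
  have hdvd : ∀ i, f (b i) = d i • ∑ j, u j i • y j := fun i => by
    simp only [hb i, hu, mul_smul, Finset.smul_sum]
  exact Submodule.sum_mem _ fun i _ => Submodule.subset_span ⟨d i, e i, b i, _, hde i, hdvd i, rfl⟩

theorem ker_lTensor_eq_torsionTensors [IsDomain R] [IsPrincipalIdealRing R] (f : N →ₗ[R] A) :
    LinearMap.ker (f.lTensor C) = torsionTensors C f := by
  refine le_antisymm (fun t ht => ?_) (torsionTensors_le_ker_lTensor f)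
  obtain ⟨P, hP, t, rfl⟩ := Submodule.exists_fg_le_eq_rTensor_subtype t
  have hzero : P.subtype.rTensor A (f.lTensor P t) = P.subtype.rTensor A 0 := by
    rw [map_zero, ← ht, ← LinearMap.comp_apply, ← LinearMap.comp_apply,
      LinearMap.rTensor_comp_lTensor, LinearMap.lTensor_comp_rTensor]
  obtain ⟨Q, hQ, hPQ, hzero⟩ := hP.exists_rTensor_fg_inclusion_eq hzero
  have hker : (Submodule.inclusion hPQ).rTensor N t ∈ LinearMap.ker (f.lTensor Q) := by
    rw [LinearMap.mem_ker, ← LinearMap.comp_apply, LinearMap.lTensor_comp_rTensor,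
      ← LinearMap.rTensor_comp_lTensor, LinearMap.comp_apply, hzero, map_zero]
  have : Module.Finite R Q := Module.Finite.iff_fg.2 hQ
  rw [← Submodule.subtype_comp_inclusion P Q hPQ, LinearMap.rTensor_comp, LinearMap.comp_apply]
  exact map_rTensor_torsionTensors_le _ f
    (Submodule.mem_map_of_mem (ker_lTensor_le_torsionTensors_of_finite f hker))

theorem exists_comp_eq_of_ker_le_ker (hM : Module.Baer R M) {f : N →ₗ[R] A} {g : N →ₗ[R] M}
    (h : LinearMap.ker f ≤ LinearMap.ker g) : ∃ g' : A →ₗ[R] M, g' ∘ₗ f = g := by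
  obtain ⟨g', hg'⟩ := hM.extension_property _
    (LinearMap.ker_eq_bot.1 (Submodule.ker_liftQ_eq_bot' _ f rfl)) ((LinearMap.ker f).liftQ g h)
  exact ⟨g', by rw [← Submodule.liftQ_mkQ _ g h, ← hg', LinearMap.comp_assoc, Submodule.liftQ_mkQ]⟩

theorem exists_bilinear_extension [IsDomain R] [IsPrincipalIdealRing R] (hM : Module.Baer R M)
    (f : N →ₗ[R] A) (φ : C →ₗ[R] N →ₗ[R] M)
    (hφ : ∀ (r : R) (c : C) (y : N) (a : A), r • c = 0 → f y = r • a → φ c y = 0) :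
    ∃ ψ : C →ₗ[R] A →ₗ[R] M, ∀ c y, ψ c (f y) = φ c y := by
  have hker : LinearMap.ker (f.lTensor C) ≤ LinearMap.ker (lift φ) := by
    rw [ker_lTensor_eq_torsionTensors, torsionTensors, Submodule.span_le]
    rintro _ ⟨r, c, y, a, hc, hy, rfl⟩
    exact hφ r c y a hc hy
  obtain ⟨Ψ, hΨ⟩ := exists_comp_eq_of_ker_le_ker hM hker
  exact ⟨curry Ψ, fun c y => LinearMap.congr_fun hΨ (c ⊗ₜ y)⟩

end Pairing

section CommGroup

variable {A C M N : Type*} [CommGroup A] [CommGroup C] [CommGroup M] [CommGroup N]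

/-- Pairings of commutative groups in multiplicative notation, seen as bilinear maps over `ℤ`. -/
def pairingEquivBilinear :
    (C →* N →* M) ≃ (Additive C →ₗ[ℤ] Additive N →ₗ[ℤ] Additive M) where
  toFun β := (AddMonoidHom.mk' (fun c => (β c.toMul).toAdditive.toIntLinearMap)
    fun c c' => by ext; simp).toIntLinearMap
  invFun φ := MonoidHom.mk'
    (fun c => MonoidHom.mk' (fun y => (φ (.ofMul c) (.ofMul y)).toMul) fun y y' => by simp)
    fun c c' => by ext; simp
  left_inv _ := rfl
  right_inv _ := rfl

theorem exists_pairing_extension (hM : Module.Baer ℤ (Additive M)) (f : N →* A) (β : C →* N →* M)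
    (hβ : ∀ (q : ℕ) (c : C) (y : N) (a : A), c ^ q = 1 → f y = a ^ q → β c y = 1) :
    ∃ γ : C →* A →* M, ∀ c y, γ c (f y) = β c y := by
  obtain ⟨ψ, hψ⟩ := exists_bilinear_extension hM f.toAdditive.toIntLinearMap
    (pairingEquivBilinear β) (fun r c y a hc hy => by
      obtain ⟨q, rfl | rfl⟩ := r.eq_nat_or_neg
      · rw [natCast_zsmul] at hc hy
        exact hβ q c.toMul y.toMul a.toMul hc hy
      · rw [neg_smul, natCast_zsmul] at hc hy
        exact hβ q c.toMul y.toMul a.toMul⁻¹ (neg_eq_zero.1 hc) (hy.trans (neg_nsmul a q).symm))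
  exact ⟨pairingEquivBilinear.symm ψ, fun c y => hψ (.ofMul c) (.ofMul y)⟩

theorem exists_pairing_modification (hM : Module.Baer ℤ (Additive M)) (B : Subgroup A)
    (b : A →* A →* M) (hb : ∀ (q : ℕ) (x y : A), x ^ q ∈ B → y ^ q ∈ B → b x y ^ q = 1) :
    ∃ γ : A →* A →* M, (∀ x ∈ B, γ x = 1) ∧ ∀ x, ∀ y ∈ B, γ x y = b x y := by
  have hB : B ≤ (b.compl₂ B.subtype).ker := fun x hx => by
    ext y
    simpa using hb 1 x y (by simpa using hx) (by simp)
  obtain ⟨γ, hγ⟩ := exists_pairing_extension hM B.subtype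
    (QuotientGroup.lift B (b.compl₂ B.subtype) hB) (by
      intro q c y a hc hy
      obtain ⟨x, rfl⟩ := QuotientGroup.mk_surjective c
      have hx : x ^ q ∈ B := (QuotientGroup.eq_one_iff _).1 hc
      calc b x y = b x a ^ q := by rw [← map_pow, ← hy, B.subtype_apply]
        _ = 1 := hb q x a hx (hy ▸ y.2))
  refine ⟨γ.comp (QuotientGroup.mk' B), fun x hx => ?_, fun x y hy => hγ x ⟨y, hy⟩⟩
  rw [MonoidHom.comp_apply, QuotientGroup.mk'_apply, (QuotientGroup.eq_one_iff x).2 hx, map_one]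

theorem exists_character_ne_one (D : Subgroup A) {c : A} (hc : c ∉ D) :
    ∃ χ : A →* Multiplicative (AddCircle (1 : ℚ)), (∀ z ∈ D, χ z = 1) ∧ χ c ≠ 1 := by
  have hne : Additive.ofMul (c : A ⧸ D) ≠ 0 := fun h => hc ((QuotientGroup.eq_one_iff c).1 h)
  obtain ⟨χ, hχ⟩ := CharacterModule.exists_character_apply_ne_zero_of_ne_zero hne
  refine ⟨(AddMonoidHom.toMultiplicativeRight (α := A ⧸ D) (β := AddCircle (1 : ℚ)) χ).comp
    (QuotientGroup.mk' D), fun z hz => ?_, hχ⟩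
  rw [MonoidHom.comp_apply, QuotientGroup.mk'_apply, (QuotientGroup.eq_one_iff z).2 hz, map_one]

theorem baer_additive_addCircle :
    Module.Baer ℤ (Additive (Multiplicative (AddCircle (1 : ℚ)))) :=
  Module.Baer.of_divisible (A := AddCircle (1 : ℚ))

end CommGroup

section ClassTwo

open scoped commutatorElement IsMulCommutative

variable {G K : Type*} [Group G] [Group K]

theorem nilpotentOfClassLE_two_iff : NilpotentOfClassLE 2 G ↔ commutator G ≤ Subgroup.center G := by
  rw [NilpotentOfClassLE, Subgroup.lowerCentralSeries_succ, Subgroup.top_lowerCentralSeries_one,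
    Subgroup.commutator_eq_bot_iff_le_centralizer, Subgroup.coe_top, Subgroup.centralizer_univ]

theorem commutatorElement_mem_commutator (x y : G) : ⁅x, y⁆ ∈ commutator G :=
  Subgroup.commutator_mem_commutator (Subgroup.mem_top x) (Subgroup.mem_top y)

theorem map_eq_one_of_mem_commutator {M : Type*} [CommGroup M] (φ : G →* M) {z : G}
    (hz : z ∈ commutator G) : φ z = 1 :=
  Abelianization.commutator_subset_ker φ hz

theorem map_pow_mul_of_mem_commutator {M : Type*} [CommGroup M] (φ : G →* M) {z : G}
    (hz : z ∈ commutator G) (x : G) (q : ℕ) : φ (x ^ q * z) = φ x ^ q := by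
  rw [map_mul, map_pow, map_eq_one_of_mem_commutator φ hz, mul_one]

namespace NilpotentOfClassLE

theorem of_surjective {c : ℕ} (hG : NilpotentOfClassLE c G) {f : G →* K}
    (hf : Function.Surjective f) : NilpotentOfClassLE c K := by
  rw [NilpotentOfClassLE, ← Subgroup.map_top_of_surjective f hf, ← Subgroup.map_lowerCentralSeries,
    hG, Subgroup.map_bot]

theorem two_of_commGroup (A : Type*) [CommGroup A] : NilpotentOfClassLE 2 A := by
  rw [nilpotentOfClassLE_two_iff, CommGroup.center_eq_top]
  exact le_top

theorem commutator_le_center (hG : NilpotentOfClassLE 2 G) : commutator G ≤ Subgroup.center G :=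
  nilpotentOfClassLE_two_iff.1 hG

theorem commute_of_mem_commutator (hG : NilpotentOfClassLE 2 G) {z : G} (hz : z ∈ commutator G)
    (x : G) : Commute x z :=
  Subgroup.mem_center_iff.1 (hG.commutator_le_center hz) x

theorem commutatorElement_mul_right (hG : NilpotentOfClassLE 2 G) (x y z : G) :
    ⁅x, y * z⁆ = ⁅x, y⁆ * ⁅x, z⁆ := by
  have h := hG.commute_of_mem_commutator (commutatorElement_mem_commutator x z) y
  rw [commutatorElement_mul_right_eq_mul_conj, mul_assoc _ y, h.eq, ← mul_assoc,
    mul_inv_cancel_right]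

theorem commutatorElement_mul_left (hG : NilpotentOfClassLE 2 G) (x y z : G) :
    ⁅x * y, z⁆ = ⁅x, z⁆ * ⁅y, z⁆ := by
  rw [← commutatorElement_inv, hG.commutatorElement_mul_right, mul_inv_rev, commutatorElement_inv,
    commutatorElement_inv,
    (hG.commute_of_mem_commutator (commutatorElement_mem_commutator x z) _).eq]

/-- The commutator of a group of class at most two, as a pairing with values in the center. -/
def commutatorPairing (hG : NilpotentOfClassLE 2 G) : G →* G →* Subgroup.center G :=
  MonoidHom.mk' (fun x => MonoidHom.mk'
    (fun y => ⟨⁅x, y⁆, hG.commutator_le_center (commutatorElement_mem_commutator x y)⟩)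
    fun y z => Subtype.ext (hG.commutatorElement_mul_right x y z))
    fun x y => MonoidHom.ext fun z => Subtype.ext (hG.commutatorElement_mul_left x y z)

@[simp]
theorem coe_commutatorPairing (hG : NilpotentOfClassLE 2 G) (x y : G) :
    (hG.commutatorPairing x y : G) = ⁅x, y⁆ := rfl

theorem inv_mul_inv_mul_mul (hG : NilpotentOfClassLE 2 G) (x y : G) :
    x⁻¹ * y⁻¹ * x * y = ⁅x, y⁆ :=
  calc x⁻¹ * y⁻¹ * x * y = hG.commutatorPairing x⁻¹ y⁻¹ := by
        rw [coe_commutatorPairing, commutatorElement_def, inv_inv, inv_inv]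
    _ = ⁅x, y⁆ := by rw [map_inv, map_inv, MonoidHom.inv_apply, inv_inv, coe_commutatorPairing]

end NilpotentOfClassLE

end ClassTwo

section Separation

open scoped commutatorElement

variable {G A M : Type*} [Group G] [CommGroup A] [CommGroup M]

/-- The action of `G` on the product `A × M` by the transvections `(s, m) ↦ (s, γ x s * m)`
attached to a pairing `γ` of `G` and `A` with values in `M`. -/
def transvection (γ : G →* A →* M) : G →* MulAut (A × M) :=
  MonoidHom.mk' (fun x =>
    { toFun := fun p => (p.1, γ x p.1 * p.2)
      invFun := fun p => (p.1, (γ x p.1)⁻¹ * p.2)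
      left_inv := fun p => by simp
      right_inv := fun p => by simp
      map_mul' := fun p p' => by ext <;> simp [mul_mul_mul_comm] })
    fun x y => by ext p <;> simp [mul_assoc]

@[simp]
theorem transvection_apply (γ : G →* A →* M) (x : G) (p : A × M) :
    transvection γ x p = (p.1, γ x p.1 * p.2) := rfl

@[simp]
theorem transvection_symm_apply (γ : G →* A →* M) (x : G) (p : A × M) :
    (transvection γ x).symm p = (p.1, (γ x p.1)⁻¹ * p.2) := rfl

theorem nilpotentOfClassLE_two_semidirectProduct (hG : NilpotentOfClassLE 2 G)
    (γ : G →* A →* M) : NilpotentOfClassLE 2 ((A × M) ⋊[transvection γ] G) := by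
  rw [nilpotentOfClassLE_two_iff, commutator_def, Subgroup.commutator_le]
  rintro a - b -
  have hr : ⁅a, b⁆.right = ⁅a.right, b.right⁆ :=
    map_commutatorElement SemidirectProduct.rightHom a b
  have hl : ⁅a, b⁆.left.1 = 1 := by simp [commutatorElement_def]
  have hz := hr ▸ commutatorElement_mem_commutator a.right b.right
  refine Subgroup.mem_center_iff.2 fun t => ?_
  ext
  · simp [hl]
  · simp [hl, map_eq_one_of_mem_commutator γ hz, mul_comm]
  · exact hG.commute_of_mem_commutator hz t.right

/-- The subgroup of `(A × M) ⋊ G` whose quotient identifies each `h ∈ H` with `π h` and each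
`z ∈ [G, G]` with `χ z`. -/
def amalgam (hG : NilpotentOfClassLE 2 G) {H : Subgroup G} (π : G →* A) {γ : G →* A →* M}
    (χ : commutator G →* M) (hγ : ∀ h ∈ H, γ h = 1) :
    Subgroup ((A × M) ⋊[transvection γ] G) where
  carrier := {t | ∃ (z : commutator G) (h : H), t = ⟨((π h)⁻¹, (χ z)⁻¹), z * h⟩}
  one_mem' := ⟨1, 1, by ext <;> simp⟩
  mul_mem' := by
    rintro _ _ ⟨z, h, rfl⟩ ⟨w, k, rfl⟩
    refine ⟨z * w, h * k, ?_⟩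
    have hw := hG.commute_of_mem_commutator w.2 h
    ext
    · simp [mul_comm]
    · simp [map_eq_one_of_mem_commutator γ z.2, hγ h h.2, mul_comm]
    · simp [mul_assoc, hw.left_comm]
  inv_mem' := by
    rintro _ ⟨z, h, rfl⟩
    refine ⟨z⁻¹, h⁻¹, ?_⟩
    have hz := hG.commute_of_mem_commutator (inv_mem z.2) (h : G)⁻¹
    ext
    · simp
    · simp [map_eq_one_of_mem_commutator γ z.2, hγ h h.2]
    · simpa using hz.eq

theorem mem_amalgam (hG : NilpotentOfClassLE 2 G) {H : Subgroup G} (π : G →* A) {γ : G →* A →* M}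
    (χ : commutator G →* M) (hγ : ∀ h ∈ H, γ h = 1) {t : (A × M) ⋊[transvection γ] G} :
    t ∈ amalgam hG π χ hγ ↔
      ∃ (z : commutator G) (h : H), t = ⟨((π h)⁻¹, (χ z)⁻¹), z * h⟩ := Iff.rfl

theorem normal_amalgam (hG : NilpotentOfClassLE 2 G) {H : Subgroup G} (π : G →* A)
    {γ : G →* A →* M} (χ : commutator G →* M) (hγ : ∀ h ∈ H, γ h = 1)
    (hχ : ∀ x, ∀ h ∈ H, γ x (π h) = χ ⟨⁅x, h⁆, commutatorElement_mem_commutator x h⟩) :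
    (amalgam hG π χ hγ).Normal := by
  refine ⟨?_⟩
  rintro _ ⟨z, h, rfl⟩ t
  let w : commutator G := ⟨⁅t.right, h⁆, commutatorElement_mem_commutator t.right h⟩
  have hw : γ t.right (π h) = χ w := hχ t.right h h.2
  have hz := hG.commute_of_mem_commutator z.2 t.right
  refine ⟨z * w, h, mul_inv_eq_iff_eq_mul.2 ?_⟩
  ext
  · simp [mul_comm]
  · have hγzw : γ (((z * w : commutator G) : G) * h) = 1 := by
      rw [map_mul, map_eq_one_of_mem_commutator γ (z * w).2, hγ h h.2, one_mul]
    change t.left.2 * (γ t.right (π h)⁻¹ * (χ z)⁻¹) =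
      (χ (z * w))⁻¹ * (γ (((z * w : commutator G) : G) * h) t.left.1 * t.left.2)
    rw [hγzw, MonoidHom.one_apply, one_mul, map_inv, hw, map_mul, mul_inv, mul_comm,
      mul_comm (χ z)⁻¹]
  · simp [w, commutatorElement_def, mul_assoc, hz.left_comm]

theorem notMem_dominion_of_pairing {G A : Type u} {M : Type} [Group G] [CommGroup A] [CommGroup M]
    (hG : NilpotentOfClassLE 2 G) {H : Subgroup G} (π : G →* A) {γ : G →* A →* M}
    (χ : commutator G →* M) (hγ : ∀ h ∈ H, γ h = 1)
    (hχ : ∀ x, ∀ h ∈ H, γ x (π h) = χ ⟨⁅x, h⁆, commutatorElement_mem_commutator x h⟩)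
    (hH : ∀ z : commutator G, (z : G) ∈ H → χ z = 1) {c : commutator G} (hc : χ c ≠ 1) :
    (c : G) ∉ dominion (NilpotentOfClassLE 2) H := by
  have := normal_amalgam hG π χ hγ hχ
  let q := QuotientGroup.mk' (amalgam hG π χ hγ)
  intro hdom
  have heq : q (SemidirectProduct.inl (π c, 1)) = q (SemidirectProduct.inr c) :=
    (hdom _ ((nilpotentOfClassLE_two_semidirectProduct hG γ).of_surjective
      (QuotientGroup.mk'_surjective _))
      (q.comp SemidirectProduct.inr)
      ((q.comp SemidirectProduct.inl).comp ((MonoidHom.inl A M).comp π))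
      fun h hh => by
        refine (QuotientGroup.eq.2 <| (mem_amalgam hG π χ hγ).2 ⟨1, ⟨h, hh⟩, ?_⟩).symm
        ext <;> simp).symm
  obtain ⟨z, h, hzh⟩ := (mem_amalgam hG π χ hγ).1 (QuotientGroup.eq.1 heq)
  have hl : χ z = 1 := by simpa using congrArg (fun t => t.left.2) hzh
  have hr : (c : G) = z * h := by simpa using congrArg (fun t => t.right) hzh
  have hcz : ((z⁻¹ * c : commutator G) : G) = h := by simp [hr]
  apply hc
  rw [← hH (z⁻¹ * c) (hcz ▸ h.2), map_mul, map_inv, hl, inv_one, one_mul]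

end Separation

section Dominion

open scoped commutatorElement IsMulCommutative

variable {G : Type u} [Group G]

theorem le_dominion (𝒞 : ∀ (K : Type u) [Group K], Prop) (H : Subgroup G) : H ≤ dominion 𝒞 H :=
  fun h hh _ _ _ _ _ hfg => hfg h hh

theorem dominion_le_sup_commutator {𝒞 : ∀ (K : Type u) [Group K], Prop}
    (h𝒞 : ∀ (A : Type u) [CommGroup A], 𝒞 A) (H : Subgroup G) :
    dominion 𝒞 H ≤ H ⊔ commutator G := by
  intro a ha
  let φ : G →* Abelianization G ⧸ H.map Abelianization.of :=
    (QuotientGroup.mk' _).comp Abelianization.of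
  have hφ : ∀ h ∈ H, φ h = 1 := fun h hh =>
    (QuotientGroup.eq_one_iff _).2 (Subgroup.mem_map_of_mem _ hh)
  have hφa : Abelianization.of a ∈ H.map Abelianization.of :=
    (QuotientGroup.eq_one_iff _).1 (ha _ (h𝒞 _) φ 1 hφ)
  rwa [← Subgroup.mem_comap, Subgroup.comap_map_eq, Abelianization.ker_of] at hφa

theorem surjective_abelianization_of :
    Function.Surjective (Abelianization.of : G →* Abelianization G) :=
  QuotientGroup.mk_surjective

theorem abelianization_of_mem_map_iff {H : Subgroup G} {x : G} :
    Abelianization.of x ∈ H.map Abelianization.of ↔ ∃ x' ∈ commutator G, x * x' ∈ H := by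
  constructor
  · rintro ⟨h, hh, hx⟩
    exact ⟨x⁻¹ * h, QuotientGroup.eq.1 hx.symm, by rwa [mul_inv_cancel_left]⟩
  · rintro ⟨x', hx', hx⟩
    refine ⟨x * x', hx, ?_⟩
    rw [map_mul, map_eq_one_of_mem_commutator _ hx', mul_one]

theorem commutatorElement_pow_mem_dominion {H : Subgroup G} {x y x' y' : G} {q : ℕ}
    (hx' : x' ∈ commutator G) (hy' : y' ∈ commutator G) (hx : x ^ q * x' ∈ H)
    (hy : y ^ q * y' ∈ H) : ⁅x, y⁆ ^ q ∈ dominion (NilpotentOfClassLE 2) H := by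
  intro K _ hK f g hfg
  let β := hK.commutatorPairing
  have hright : ∀ φ : G →* K, ∀ k, β k (φ y) ^ q = β k (φ (y ^ q * y')) :=
    fun φ k => (map_pow_mul_of_mem_commutator ((β k).comp φ) hy' y q).symm
  have hleft : ∀ φ : G →* K, ∀ k, β (φ x) k ^ q = β (φ (x ^ q * x')) k :=
    fun φ k => (map_pow_mul_of_mem_commutator ((β.flip k).comp φ) hx' x q).symm
  have h : β (f x) (f y) ^ q = β (g x) (g y) ^ q :=
    calc β (f x) (f y) ^ q = β (f x) (g y) ^ q := by rw [hright, hright, hfg _ hy]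
      _ = β (g x) (g y) ^ q := by rw [hleft, hleft, hfg _ hx]
  simpa [β, map_commutatorElement] using congrArg Subtype.val h

/-- The pairing on the abelianization induced by a pairing on a group. -/
def abelianizationPairing {M : Type*} [CommGroup M] (β : G →* G →* M) :
    Abelianization G →* Abelianization G →* M :=
  (Abelianization.lift (Abelianization.lift β).flip).flip

theorem mem_of_mem_dominion_of_mem_commutator (hG : NilpotentOfClassLE 2 G) {H D : Subgroup G}
    (hHD : H ≤ D)
    (hD : ∀ (q : ℕ) (x y : G), (∃ x' ∈ commutator G, x ^ q * x' ∈ H) →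
      (∃ y' ∈ commutator G, y ^ q * y' ∈ H) → ⁅x, y⁆ ^ q ∈ D)
    {c : G} (hc : c ∈ commutator G) (hdom : c ∈ dominion (NilpotentOfClassLE 2) H) : c ∈ D := by
  by_contra hcD
  let ι := Subgroup.inclusion hG.commutator_le_center
  obtain ⟨χ, hχD, hχc⟩ :=
    exists_character_ne_one (D.subgroupOf (Subgroup.center G)) (c := ι ⟨c, hc⟩) hcD
  let b := abelianizationPairing (hG.commutatorPairing.compr₂ χ)
  have hb : ∀ (q : ℕ) (x y : Abelianization G), x ^ q ∈ H.map Abelianization.of →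
      y ^ q ∈ H.map Abelianization.of → b x y ^ q = 1 := by
    intro q x y hx hy
    obtain ⟨x, rfl⟩ := surjective_abelianization_of x
    obtain ⟨y, rfl⟩ := surjective_abelianization_of y
    rw [← map_pow, abelianization_of_mem_map_iff] at hx hy
    calc b (.of x) (.of y) ^ q = χ (hG.commutatorPairing x y ^ q) := (map_pow χ _ q).symm
      _ = 1 := hχD _ (hD q x y hx hy)
  obtain ⟨γ, hγ, hγb⟩ := exists_pairing_modification baer_additive_addCircle _ b hb
  exact notMem_dominion_of_pairing hG Abelianization.of (γ := γ.comp Abelianization.of) (χ.comp ι)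
    (fun h hh => hγ _ (Subgroup.mem_map_of_mem _ hh))
    (fun x h hh => hγb _ _ (Subgroup.mem_map_of_mem _ hh))
    (fun z hz => hχD _ (hHD hz)) (c := ⟨c, hc⟩) hχc hdom

end Dominion

theorem theorem3p31 {G : Type u} [Group G] (hG : NilpotentOfClassLE 2 G) (H : Subgroup G) :
    dominion (fun (K : Type u) [Group K] => NilpotentOfClassLE 2 K) H =
      Subgroup.closure ((H : Set G) ∪
        {d | ∃ (x y : G) (q : ℕ) (x' y' : G), x' ∈ commutator G ∧ y' ∈ commutator G ∧
          x ^ q * x' ∈ H ∧ y ^ q * y' ∈ H ∧ d = (x⁻¹ * y⁻¹ * x * y) ^ q}) := by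
  refine le_antisymm (fun a ha => ?_) ?_
  · obtain ⟨h, hh, c, hc, rfl⟩ := Subgroup.mem_sup_of_normal_right.1
      (dominion_le_sup_commutator (fun A _ => NilpotentOfClassLE.two_of_commGroup A) H ha)
    have hcdom := (Subgroup.mul_mem_cancel_left _ (le_dominion _ H hh)).1 ha
    refine mul_mem (Subgroup.subset_closure (.inl hh)) (mem_of_mem_dominion_of_mem_commutator hG
      (fun k hk => Subgroup.subset_closure (.inl hk)) ?_ hc hcdom)
    rintro q x y ⟨x', hx', hx⟩ ⟨y', hy', hy⟩
    exact Subgroup.subset_closure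
      (.inr ⟨x, y, q, x', y', hx', hy', hx, hy, by rw [hG.inv_mul_inv_mul_mul]⟩)
  · rw [Subgroup.closure_le, Set.union_subset_iff]
    refine ⟨le_dominion _ H, ?_⟩
    rintro _ ⟨x, y, q, x', y', hx', hy', hx, hy, rfl⟩
    rw [hG.inv_mul_inv_mul_mul]
    exact commutatorElement_pow_mem_dominion hx' hy' hx hy
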